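/- Let $B>0$. Let $\mathrm{PW}^2_B$ be the set of functions $f:\mathbb{C}\to\mathbb{C}$ for which there is $F\in L^2([-B,B])$ with $f(z)=\int_{-B}^{B}F(\xi)e^{2\pi i\xi z}\,d\xi$ for all $z\in\mathbb{C}$. For $\phi\in L^2(\mathbb{R})$ and $f:\mathbb{C}\to\mathbb{C}$ whose restriction to $\mathbb{R}$ is in $L^2(\mathbb{R})$, let $$\mathcal{V}_\phi f(x,\omega)=\int_{\mathbb{R}}f(t)\,\overline{\phi(t-x)}\,e^{-2\pi i t\omega}\,dt,\qquad x,\omega\in\mathbb{R},$$ be the short-time Fourier transform of $f$ with window $\phi$, and let $\mathcal{F}$ be the Fourier transform on $L^2(\mathbb{R})$, i.e. the continuous extension of $\mathcal{F}\phi(\xi)=\int_{\mathbb{R}}\phi(t)e^{-2\pi i t\xi}\,dt$. Let $\phi\in L^2(\mathbb{R})$ be real-valued with $(\mathcal{F}\phi)(\xi)\neq 0$ for almost every $\xi\in(-B,B)$. Then, for all $f,g\in\mathrm{PW}^2_B$ that are real-valued on the real line, the following are equivalent: 1. $f=g$ or $f=-g$. 2. $\left|\mathcal{V}_\phi f\left(\frac{n}{4B},0\right)\right|=\left|\mathcal{V}_\phi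 g\left(\frac{n}{4B},0\right)\right|$ for all $n\in\mathbb{Z}$. -/

import Mathlib

open MeasureTheory
open scoped FourierTransform ComplexConjugate

/-- The short-time Fourier transform of `f` with window `φ`,
`V_φ f (x, ω) = ∫ f(t) conj(φ(t - x)) e^{-2πitω} dt`. -/
noncomputable def stft (φ f : ℝ → ℂ) (x ω : ℝ) : ℂ :=
  ∫ t : ℝ, f t * conj (φ (t - x)) * Complex.exp (-2 * Real.pi * Complex.I * t * ω)

/-- The Paley--Wiener space `PW^2_B`: the functions `f : ℂ → ℂ` of the form
`f(z) = ∫_{-B}^{B} F(ξ) e^{2πiξz} dξ` with `F ∈ L²([-B, B])`. -/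
def paleyWiener2 (B : ℝ) : Set (ℂ → ℂ) :=
  {f | ∃ F : ℝ → ℂ, MemLp F 2 (volume.restrict (Set.Icc (-B) B)) ∧
    ∀ z : ℂ, f z = ∫ ξ in Set.Icc (-B) B, F ξ * Complex.exp (2 * Real.pi * Complex.I * ξ * z)}

open scoped SchwartzMap

/-! By Parseval, `V_φ f (·, 0)` is, up to reflection, the Fourier transform of `F · conj (𝓕 φ)`,
which lives on `[-B, B]`. Both transforms being real, equal moduli mean equal squares. A difference
of squares `(a - b)(a + b)` of such transforms is the transform of a convolution supported in `[-2B,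
2B]`, for which `(4B)⁻¹ℤ` is the Nyquist lattice: vanishing at the samples forces it to vanish
identically (`ae_eq_zero_of_fourier_eq_zero`). Both factors are analytic, so one of them is zero;
cancelling `conj (𝓕 φ)` leaves `F = ±G` almost everywhere, hence `f = ±g`. -/

theorem integral_fourierInv_smul_eq {f g : ℝ → ℂ} (hf : Integrable f) (hg : Integrable g) :
    ∫ t, 𝓕⁻ f t • g t = ∫ ξ, f ξ • 𝓕⁻ g ξ := by
  have hL : Continuous fun p : ℝ × ℝ ↦ (-innerₗ ℝ) p.1 p.2 := by
    simp only [LinearMap.neg_apply, innerₗ_apply_apply]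
    fun_prop
  have hflip : (-innerₗ ℝ).flip = -innerₗ ℝ := by
    ext
    simp
  have h := VectorFourier.integral_fourierIntegral_smul_eq_flip (L := -innerₗ ℝ)
    (μ := volume) (ν := volume) Real.continuous_fourierChar hL hf hg
  rw [hflip] at h
  exact h

theorem continuous_fourierInv_of_integrable {f : ℝ → ℂ} (hf : Integrable f) :
    Continuous (𝓕⁻ f) := by
  have hL : Continuous fun p : ℝ × ℝ ↦ (-innerₗ ℝ) p.1 p.2 := by
    simp only [LinearMap.neg_apply, innerₗ_apply_apply]
    fun_prop
  exact VectorFourier.fourierIntegral_continuous Real.continuous_fourierChar hL hf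

/-- On `L¹ ∩ L²` the inverse Fourier transform on `L²` is given by the inverse Fourier integral. -/
theorem coeFn_fourierInv_toLp {f : ℝ → ℂ} (hf : Integrable f) (hf2 : MemLp f 2 volume) :
    ((𝓕⁻ (hf2.toLp f) : Lp ℂ 2 (volume : Measure ℝ)) : ℝ → ℂ) =ᵐ[volume] 𝓕⁻ f := by
  refine ae_eq_of_integral_contDiff_smul_eq
    ((Lp.memLp _).locallyIntegrable one_le_two)
    (continuous_fourierInv_of_integrable hf).locallyIntegrable fun g hg hgc ↦ ?_
  have hgc' : HasCompactSupport (fun x ↦ (g x : ℂ)) := hgc.comp_left (g := Complex.ofReal) rfl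
  -- As a Schwartz function, `ψ` can be paired with the tempered distribution of `f`, whose inverse
  -- transform is defined by duality.
  let ψ : 𝓢(ℝ, ℂ) := hgc'.toSchwartzMap (Complex.ofRealCLM.contDiff.comp hg)
  have h := DFunLike.congr_fun (Lp.fourierInv_toTemperedDistribution_eq (hf2.toLp f)) ψ
  rw [TemperedDistribution.fourierInv_apply, Lp.toTemperedDistribution_apply,
    Lp.toTemperedDistribution_apply] at h
  have h1 : ∫ x, (𝓕⁻ ψ) x • (hf2.toLp f : ℝ → ℂ) x = ∫ x, 𝓕⁻ (ψ : ℝ → ℂ) x • f x := by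
    refine integral_congr_ae ?_
    filter_upwards [hf2.coeFn_toLp] with x hx
    rw [hx, SchwartzMap.fourierInv_coe]
  rw [h1, integral_fourierInv_smul_eq ψ.integrable hf] at h
  simpa [ψ] using! h.symm

theorem integral_fourierInv_mul_conj {f φ : ℝ → ℂ} (hf : Integrable f) (hf2 : MemLp f 2 volume)
    (hφ : MemLp φ 2 volume) :
    ∫ t, 𝓕⁻ f t * conj (φ t) =
      ∫ ξ, f ξ * conj ((𝓕 (hφ.toLp φ) : Lp ℂ 2 (volume : Measure ℝ)) ξ) := by
  have h := Lp.inner_fourier_eq (hφ.toLp φ) (𝓕⁻ (hf2.toLp f))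
  rw [FourierTransform.fourier_fourierInv_eq, L2.inner_def, L2.inner_def] at h
  convert! h.symm using 1
  · refine integral_congr_ae ?_
    filter_upwards [hφ.coeFn_toLp, coeFn_fourierInv_toLp hf hf2] with x h1 h2
    simp [h1, h2]
  · refine integral_congr_ae ?_
    filter_upwards [hf2.coeFn_toLp] with x h1
    simp [h1]

/-! ### Uniqueness for Fourier transforms of compactly supported functions -/

/-- An integrable function on `[-R, R]` whose Fourier coefficients all vanish is zero. -/
theorem ae_eq_zero_of_fourier_eq_zero {R : ℝ} (hR : 0 < R) {h : ℝ → ℂ} (hh : Integrable h)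
    (hsupp : ∀ x ∉ Set.Icc (-R) R, h x = 0) (hz : ∀ n : ℤ, 𝓕 h (n / (2 * R)) = 0) :
    h =ᵐ[volume] 0 := by
  have : Fact (0 < 2 * R) := ⟨by positivity⟩
  have hint (c : C(AddCircle (2 * R), ℂ)) : Integrable fun x : ℝ ↦ c x * h x :=
    hh.bdd_mul (c.continuous.comp (AddCircle.continuous_mk' _)).aestronglyMeasurable
      (c := ‖c‖) (.of_forall fun x ↦ c.norm_coe_le_norm _)
  let L : C(AddCircle (2 * R), ℂ) →L[ℂ] ℂ := LinearMap.mkContinuous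
    { toFun := fun c ↦ ∫ x : ℝ, c x * h x
      map_add' := fun c d ↦ by
        simp only [ContinuousMap.add_apply, add_mul]
        exact integral_add (hint c) (hint d)
      map_smul' := fun a c ↦ by
        simp only [ContinuousMap.smul_apply, smul_eq_mul, mul_assoc, RingHom.id_apply]
        exact integral_const_mul _ _ } (∫ x, ‖h x‖) fun c ↦ by
      refine (norm_integral_le_integral_norm _).trans ?_
      rw [← integral_mul_const]
      refine integral_mono (hint c).norm (hh.norm.mul_const _) fun x ↦ ?_
      simp only [norm_mul, mul_comm ‖h x‖]
      gcongr
      exact c.norm_coe_le_norm _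
  have hL (c) : L c = ∫ x : ℝ, c x * h x := rfl
  have hLz : ∀ c, L c = 0 := by
    intro c
    -- The closed kernel of `L` contains every Fourier monomial, and these span a dense subspace of
    -- `C(AddCircle (2 * R), ℂ)`.
    have hker : (Submodule.span ℂ (Set.range (@fourier (2 * R)))).topologicalClosure ≤
        L.toLinearMap.ker := by
      refine Submodule.topologicalClosure_minimal _ (Submodule.span_le.2 ?_) L.isClosed_ker
      rintro _ ⟨n, rfl⟩
      change L _ = 0
      rw [hL, ← hz (-n), Real.fourier_real_eq_integral_exp_smul]
      refine integral_congr_ae (.of_forall fun x ↦ ?_)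
      simp only [fourier_coe_apply, smul_eq_mul]
      congr 2
      push_cast
      ring
    rw [span_fourier_closure_eq_top] at hker
    exact hker trivial
  have hIoo : ∀ᵐ x, x ∈ Set.Ioo (-R) R → h x = 0 := by
    refine isOpen_Ioo.ae_eq_zero_of_integral_contDiff_smul_eq_zero
      (hh.locallyIntegrable.locallyIntegrableOn _) fun g hg _ hgs ↦ ?_
    have hg0 : ∀ x ∉ Set.Ioo (-R) R, g x = 0 := fun x hx ↦
      image_eq_zero_of_notMem_tsupport fun h' ↦ hx (hgs h')
    -- A test function supported in the open interval vanishes at both endpoints, so it descends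
    -- continuously to the circle.
    let c : C(AddCircle (2 * R), ℂ) := ⟨AddCircle.liftIco (2 * R) (-R) fun x ↦ (g x : ℂ),
      AddCircle.liftIco_continuous (by rw [hg0 _ (by simp), hg0 _ (by simp; intro; linarith)])
        (Complex.continuous_ofReal.comp hg.continuous).continuousOn⟩
    rw [← hLz c, hL]
    refine integral_congr_ae ?_
    filter_upwards [Measure.ae_ne volume R] with x hxR
    by_cases hx : x ∈ Set.Icc (-R) R
    · have hx' : x ∈ Set.Ico (-R) (-R + 2 * R) :=
        ⟨hx.1, by linarith [lt_of_le_of_ne hx.2 hxR]⟩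
      have : c x = g x := AddCircle.liftIco_coe_apply (f := fun x ↦ (g x : ℂ)) hx'
      simp [this]
    · simp [hsupp x hx]
  filter_upwards [hIoo, Measure.ae_ne volume R, Measure.ae_ne volume (-R)] with x h1 h2 h3
  by_cases hx : x ∈ Set.Icc (-R) R
  · exact h1 ⟨lt_of_le_of_ne hx.1 h3.symm, lt_of_le_of_ne hx.2 h2⟩
  · exact hsupp x hx

/-- The Fourier transform of a compactly supported integrable function is real analytic. -/
theorem analyticOnNhd_fourier_of_support_subset {R : ℝ} {h : ℝ → ℂ} (hh : Integrable h)
    (hsupp : ∀ x ∉ Set.Icc (-R) R, h x = 0) : AnalyticOnNhd ℝ (𝓕 h) Set.univ := by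
  -- Allowing complex frequencies makes the integral an entire function; analyticity on `ℝ` follows
  -- by restriction.
  let k : ℂ → ℝ → ℂ := fun z x ↦ Complex.exp (-2 * Real.pi * x * Complex.I * z) * h x
  let k' : ℂ → ℝ → ℂ := fun z x ↦
    (-2 * Real.pi * x * Complex.I) * Complex.exp (-2 * Real.pi * x * Complex.I * z) * h x
  have hmeas (z) : AEStronglyMeasurable (k z) volume :=
    (Continuous.aestronglyMeasurable (by fun_prop)).mul hh.1
  have hmeas' (z) : AEStronglyMeasurable (k' z) volume :=
    (Continuous.aestronglyMeasurable (by fun_prop)).mul hh.1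
  have hexp (r : ℝ) (z : ℂ) (hz : ‖z‖ ≤ r) (x : ℝ) (hx : x ∈ Set.Icc (-R) R) :
      ‖Complex.exp (-2 * Real.pi * x * Complex.I * z)‖ ≤ Real.exp (2 * Real.pi * R * r) := by
    refine (Complex.norm_exp_le_exp_norm _).trans (Real.exp_le_exp.2 ?_)
    have : |x| ≤ R := abs_le.2 hx
    have : 0 ≤ R := (abs_nonneg x).trans this
    simp only [norm_mul, norm_neg, Complex.norm_ofNat, Complex.norm_real, Real.norm_eq_abs,
      Complex.norm_I, mul_one, abs_of_pos Real.pi_pos]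
    gcongr
  have hk (z) : Integrable (k z) := by
    refine (hh.norm.const_mul (Real.exp (2 * Real.pi * R * ‖z‖))).mono' (hmeas z)
      (.of_forall fun x ↦ ?_)
    by_cases hx : x ∈ Set.Icc (-R) R
    · simp only [k, norm_mul]
      gcongr
      exact hexp _ z le_rfl x hx
    · simp [k, hsupp x hx]
  have hdiff : Differentiable ℂ fun z ↦ ∫ x, k z x := by
    intro z
    refine (hasDerivAt_integral_of_dominated_loc_of_deriv_le (F := k) (F' := k')
      (bound := fun x ↦ 2 * Real.pi * R * Real.exp (2 * Real.pi * R * (‖z‖ + 1)) * ‖h x‖)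
      (Metric.ball_mem_nhds z one_pos) (.of_forall hmeas) (hk z) (hmeas' z)
      (.of_forall fun x w hw ↦ ?_) (hh.norm.const_mul _)
      (.of_forall fun x w hw ↦ ?_)).2.differentiableAt
    · by_cases hx : x ∈ Set.Icc (-R) R
      · have h1 : |x| ≤ R := abs_le.2 hx
        have h2 : 0 ≤ R := (abs_nonneg x).trans h1
        have h3 : ‖w‖ ≤ ‖z‖ + 1 := by
          have := norm_le_norm_add_norm_sub' w z
          rw [Metric.mem_ball, dist_eq_norm] at hw
          linarith
        simp only [k', norm_mul, norm_neg, Complex.norm_ofNat, Complex.norm_real,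
          Real.norm_eq_abs, Complex.norm_I, mul_one, abs_of_pos Real.pi_pos]
        gcongr
        exact hexp _ w h3 x hx
      · simp [k', hsupp x hx]
    · have h1 := ((hasDerivAt_id w).const_mul (-2 * Real.pi * x * Complex.I : ℂ)).cexp.mul_const
        (h x)
      simp only [id, mul_one] at h1
      convert! h1 using 1
      simp only [k']
      ring
  have heq : 𝓕 h = (fun z ↦ ∫ x, k z x) ∘ Complex.ofRealCLM := by
    ext w
    rw [Real.fourier_real_eq_integral_exp_smul]
    refine integral_congr_ae (.of_forall fun x ↦ ?_)
    simp only [k, smul_eq_mul, Complex.ofRealCLM_apply]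
    congr 2
    push_cast
    ring
  rw [heq]
  exact fun w _ ↦ ((hdiff.analyticAt _).restrictScalars).comp (Complex.ofRealCLM.analyticAt w)

/-- If the squares of the Fourier transforms of two integrable functions on `[-B, B]` agree on
`(4B)⁻¹ℤ`, then the functions agree up to a sign. -/
theorem ae_eq_or_eq_neg_of_fourier_sq_eq {B : ℝ} (hB : 0 < B) {F G : ℝ → ℂ} (hF : Integrable F)
    (hG : Integrable G) (hFs : ∀ x ∉ Set.Icc (-B) B, F x = 0)
    (hGs : ∀ x ∉ Set.Icc (-B) B, G x = 0)
    (hz : ∀ n : ℤ, 𝓕 F (n / (4 * B)) ^ 2 = 𝓕 G (n / (4 * B)) ^ 2) :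
    F =ᵐ[volume] G ∨ F =ᵐ[volume] -G := by
  let μ := ContinuousLinearMap.mul ℂ ℂ
  have hF' (w) : Integrable fun v ↦ Real.fourierChar (-(v * w)) • F v := by
    simpa [mul_comm] using (Real.fourierIntegral_convergent_iff w).2 hF
  have hG' (w) : Integrable fun v ↦ Real.fourierChar (-(v * w)) • G v := by
    simpa [mul_comm] using (Real.fourierIntegral_convergent_iff w).2 hG
  have hadd (w) : 𝓕 (F + G) w = 𝓕 F w + 𝓕 G w := by
    simp only [Real.fourier_real_eq, Pi.add_apply, smul_add]
    exact integral_add (hF' w) (hG' w)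
  have hsub (w) : 𝓕 (F - G) w = 𝓕 F w - 𝓕 G w := by
    simp only [Real.fourier_real_eq, Pi.sub_apply, smul_sub]
    exact integral_sub (hF' w) (hG' w)
  -- The convolution theorem needs only `L¹`, and supports add, which doubles the radius to `2 * B`.
  have hconv : Integrable (convolution (F - G) (F + G) μ volume) :=
    (hF.sub hG).integrable_convolution μ (hF.add hG)
  have hmul (w) : 𝓕 (convolution (F - G) (F + G) μ volume) w = 𝓕 (F - G) w * 𝓕 (F + G) w :=
    Real.fourier_mul_convolution_eq (hF.sub hG) (hF.add hG) w
  have h0 : convolution (F - G) (F + G) μ volume =ᵐ[volume] 0 := by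
    refine ae_eq_zero_of_fourier_eq_zero (R := 2 * B) (by positivity) hconv (fun x hx ↦ ?_)
      fun n ↦ ?_
    · by_contra hne
      obtain ⟨a, ha, b, hb, rfl⟩ := support_convolution_subset μ hne
      have ha' : a ∈ Set.Icc (-B) B := by
        by_contra h'; exact ha (by simp [hFs a h', hGs a h'])
      have hb' : b ∈ Set.Icc (-B) B := by
        by_contra h'; exact hb (by simp [hFs b h', hGs b h'])
      exact hx ⟨by linarith [ha'.1, hb'.1], by linarith [ha'.2, hb'.2]⟩
    · rw [hmul, hsub, hadd]
      have := hz n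
      rw [show 2 * (2 * B) = 4 * B by ring]
      linear_combination this
  have hprod (w : ℝ) : 𝓕 (F - G) w * 𝓕 (F + G) w = 0 := by
    rw [← hmul, Real.fourier_congr_ae h0]
    simp [Real.fourier_real_eq]
  have key {H : ℝ → ℂ} (hH : Integrable H) (hHs : ∀ x ∉ Set.Icc (-B) B, H x = 0)
      (h : ∀ w ∈ Set.univ, 𝓕 H w = 0) : H =ᵐ[volume] 0 :=
    ae_eq_zero_of_fourier_eq_zero hB hH hHs fun n ↦ h _ trivial
  have hs1 : ∀ x ∉ Set.Icc (-B) B, (F - G) x = 0 := fun x hx ↦ by simp [hFs x hx, hGs x hx]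
  have hs2 : ∀ x ∉ Set.Icc (-B) B, (F + G) x = 0 := fun x hx ↦ by simp [hFs x hx, hGs x hx]
  rcases (analyticOnNhd_fourier_of_support_subset
    (hF.sub hG) hs1).eq_zero_or_eq_zero_of_mul_eq_zero
      (analyticOnNhd_fourier_of_support_subset (hF.add hG) hs2) (fun w _ ↦ hprod w)
      isPreconnected_univ with h | h
  · left
    filter_upwards [key (hF.sub hG) hs1 h] with x hx
    exact sub_eq_zero.1 hx
  · right
    filter_upwards [key (hF.add hG) hs2 h] with x hx
    exact eq_neg_of_add_eq_zero_left hx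

/-! ### The short-time Fourier transform at frequency zero -/

/-- For `f(t) = ∫_{-B}^{B} F(ξ) e^{2πiξt} dξ`, the function `V_φ f (·, 0)` is the inverse Fourier
integral of `F · conj (𝓕 φ)`. -/
theorem stft_zero_eq_fourier {B : ℝ} {φ F : ℝ → ℂ} (hφ : MemLp φ 2 volume)
    (hF : MemLp F 2 (volume.restrict (Set.Icc (-B) B))) {f : ℂ → ℂ}
    (hf : ∀ z : ℂ, f z = ∫ ξ in Set.Icc (-B) B, F ξ * Complex.exp (2 * Real.pi * Complex.I * ξ * z))
    (x : ℝ) :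
    stft φ (fun t : ℝ ↦ f t) x 0 = 𝓕 (fun ξ ↦ (Set.Icc (-B) B).indicator F ξ *
      conj ((𝓕 (hφ.toLp φ) : Lp ℂ 2 (volume : Measure ℝ)) ξ)) (-x) := by
  let e : ℝ → ℂ := fun ξ ↦ Complex.exp (2 * Real.pi * Complex.I * ξ * x)
  -- The time shift by `x` becomes the unimodular factor `e`, so `k` stays in `L¹ ∩ L²`.
  let k : ℝ → ℂ := fun ξ ↦ e ξ * (Set.Icc (-B) B).indicator F ξ
  have he : Continuous e := by fun_prop
  have hnorm (ξ) : ‖e ξ‖ = 1 := by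
    rw [← Complex.norm_exp_ofReal_mul_I (2 * Real.pi * ξ * x)]
    simp only [e]
    congr 2
    push_cast
    ring
  have hi2 : MemLp ((Set.Icc (-B) B).indicator F) 2 volume :=
    (memLp_indicator_iff_restrict measurableSet_Icc).2 hF
  have hi1 : Integrable ((Set.Icc (-B) B).indicator F) :=
    (integrable_indicator_iff measurableSet_Icc).2 (hF.integrable one_le_two)
  have hk2 : MemLp k 2 volume :=
    hi2.of_le (he.aestronglyMeasurable.mul hi2.1) (.of_forall fun ξ ↦ by simp [k, hnorm])
  have hk1 : Integrable k :=
    hi1.mono (he.aestronglyMeasurable.mul hi1.1) (.of_forall fun ξ ↦ by simp [k, hnorm])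
  have hshift (t : ℝ) : f ((t + x : ℝ) : ℂ) = 𝓕⁻ k t := by
    rw [hf, Real.fourierInv_eq_fourier_neg, Real.fourier_real_eq_integral_exp_smul,
      ← integral_indicator measurableSet_Icc]
    refine integral_congr_ae (.of_forall fun ξ ↦ ?_)
    by_cases hξ : ξ ∈ Set.Icc (-B) B
    · simp only [Set.indicator_of_mem hξ, k, e, smul_eq_mul, ← mul_assoc, ← Complex.exp_add]
      rw [mul_comm]
      congr 2
      push_cast
      ring
    · simp [Set.indicator_of_notMem hξ, k]
  calc stft φ (fun t : ℝ ↦ f t) x 0 = ∫ t : ℝ, f t * conj (φ (t - x)) := by simp [stft]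
    _ = ∫ t : ℝ, f ((t + x : ℝ) : ℂ) * conj (φ t) := by
      rw [← integral_add_right_eq_self _ x]
      simp
    _ = ∫ ξ, k ξ * conj ((𝓕 (hφ.toLp φ) : Lp ℂ 2 (volume : Measure ℝ)) ξ) := by
      simp only [hshift]
      exact integral_fourierInv_mul_conj hk1 hk2 hφ
    _ = _ := by
      rw [Real.fourier_real_eq_integral_exp_smul]
      refine integral_congr_ae (.of_forall fun ξ ↦ ?_)
      simp only [k, e, smul_eq_mul, mul_assoc]
      congr 2
      push_cast
      ring

theorem stft_zero_im {φ f : ℝ → ℂ} (hφ : ∀ᵐ t : ℝ, (φ t).im = 0) (hf : ∀ t, (f t).im = 0)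
    (x : ℝ) : (stft φ f x 0).im = 0 := by
  have h : stft φ f x 0 = ∫ t : ℝ, (((f t).re * (φ (t - x)).re : ℝ) : ℂ) := by
    refine integral_congr_ae ?_
    filter_upwards [(measurePreserving_sub_right volume x).quasiMeasurePreserving.ae hφ] with t ht
    apply Complex.ext <;> simp [hf t, ht]
  rw [h, integral_complex_ofReal, Complex.ofReal_im]

theorem sq_eq_sq_of_norm_eq_of_im_eq_zero {z w : ℂ} (hz : z.im = 0) (hw : w.im = 0)
    (h : ‖z‖ = ‖w‖) : z ^ 2 = w ^ 2 := by
  lift z to ℝ using hz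
  lift w to ℝ using hw
  rw [Complex.norm_real, Complex.norm_real, Real.norm_eq_abs, Real.norm_eq_abs,
    ← sq_eq_sq_iff_abs_eq_abs] at h
  exact_mod_cast h

theorem theorem2 (B : ℝ) (hB : 0 < B) (φ : ℝ → ℂ) (hφ : MemLp φ 2 volume)
    (hφ_real : ∀ᵐ t : ℝ, (φ t).im = 0)
    (hφ_fourier : ∀ᵐ ξ ∂(volume.restrict (Set.Ioo (-B) B)),
      (𝓕 (hφ.toLp φ) : Lp ℂ 2 (volume : Measure ℝ)) ξ ≠ 0)
    (f g : ℂ → ℂ) (hf : f ∈ paleyWiener2 B) (hg : g ∈ paleyWiener2 B)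
    (hf_real : ∀ t : ℝ, (f t).im = 0) (hg_real : ∀ t : ℝ, (g t).im = 0) :
    (f = g ∨ f = -g) ↔
      ∀ n : ℤ, ‖stft φ (fun t : ℝ => f t) (n / (4 * B)) 0‖ =
        ‖stft φ (fun t : ℝ => g t) (n / (4 * B)) 0‖ := by
  constructor
  · rintro (rfl | rfl) n
    · rfl
    · simp [stft, integral_neg]
  intro h
  obtain ⟨F, hF, hfF⟩ := hf
  obtain ⟨G, hG, hgG⟩ := hg
  let Φ : ℝ → ℂ := (𝓕 (hφ.toLp φ) : Lp ℂ 2 (volume : Measure ℝ))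
  have hint {H : ℝ → ℂ} (hH : MemLp H 2 (volume.restrict (Set.Icc (-B) B))) :
      Integrable fun ξ ↦ (Set.Icc (-B) B).indicator H ξ * conj (Φ ξ) :=
    ((memLp_indicator_iff_restrict measurableSet_Icc).2 hH).integrable_mul (Lp.memLp _).star
  have hsupp (H : ℝ → ℂ) : ∀ ξ ∉ Set.Icc (-B) B,
      (Set.Icc (-B) B).indicator H ξ * conj (Φ ξ) = 0 := fun ξ hξ ↦ by
    simp [Set.indicator_of_notMem hξ]
  have hne : ∀ᵐ ξ ∂(volume.restrict (Set.Icc (-B) B)), conj (Φ ξ) ≠ 0 := by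
    rw [← restrict_Ioo_eq_restrict_Icc]
    filter_upwards [hφ_fourier] with ξ hξ
    simpa using hξ
  rcases ae_eq_or_eq_neg_of_fourier_sq_eq hB (hint hF) (hint hG) (hsupp F) (hsupp G) (fun n ↦ by
    -- The sample `-n` offsets the reflection `-x` in `stft_zero_eq_fourier`.
    have hn := sq_eq_sq_of_norm_eq_of_im_eq_zero (stft_zero_im hφ_real hf_real _)
      (stft_zero_im hφ_real hg_real _) (h (-n))
    rw [stft_zero_eq_fourier hφ hF hfF, stft_zero_eq_fourier hφ hG hgG] at hn
    simpa [neg_div] using! hn) with hFG | hFG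
  · left
    ext z
    rw [hfF, hgG]
    refine integral_congr_ae ?_
    filter_upwards [hne, ae_restrict_of_ae hFG, ae_restrict_mem measurableSet_Icc] with ξ h1 h2 h3
    simp only [Set.indicator_of_mem h3] at h2
    rw [mul_right_cancel₀ h1 h2]
  · right
    ext z
    rw [Pi.neg_apply, hfF, hgG, ← integral_neg]
    refine integral_congr_ae ?_
    filter_upwards [hne, ae_restrict_of_ae hFG, ae_restrict_mem measurableSet_Icc] with ξ h1 h2 h3
    simp only [Pi.neg_apply, Set.indicator_of_mem h3, ← neg_mul] at h2
    rw [mul_right_cancel₀ h1 h2, neg_mul]
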